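/- \textbf{Definitions.} A \emph{semi-arc visibility representation} is a finite family of pairwise disjoint closed circular arcs in the plane that are concentric (with common center $c$ and positive radii), all have one endpoint on the same radial ray from $c$, and extend counterclockwise from that ray through an angle strictly between $0$ and $2\pi$. A \emph{line of sight} between two of these arcs is a line segment with one end on each of the two arcs that lies on a line through $c$; it may pass through $c$. For an integer $k\ge 0$, the \emph{semi-arc $k$-visibility graph} of the representation has one vertex for each arc, and two distinct vertices are adjacent if and only if some line of sight between their arcs meets at most $k$ of the other arcs (an arc met twice is counted only once). A graph is a semi-arc $k$-visibility graph if it is the semi-arc $k$-visibility graph of some such representation. The \emph{thickness} $\theta(G)$ of a graph $G$ is the smallest number of planar graphs into which the edges of $G$ can be partitioned. \textbf{Theorem.} For every integer $k\ge 0$, every semi-arc $k$-visibility graph $G$ satisfies $$\theta(G)\le 2k+1.$$ -/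

import Mathlib

/-- A semi-arc visibility representation with one arc for each element of `V`: pairwise disjoint
concentric closed circular arcs in the plane `ℂ`, all starting on the same radial ray (the ray of
argument `start` from `center`) and extending counterclockwise. The arc of `v` has radius
`radius v` and subtends the angle `sweep v`, which lies strictly between `0` and `2π`. -/
structure SemiArcRepresentation (V : Type*) where
  center : ℂ
  start : ℝ
  radius : V → ℝ
  sweep : V → ℝ
  radius_pos : ∀ v, 0 < radius v
  sweep_pos : ∀ v, 0 < sweep v
  sweep_lt : ∀ v, sweep v < 2 * Real.pi
  disjoint_arcs : ∀ u v, u ≠ v → Disjoint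
    ((fun t : ℝ => center + radius u * Complex.exp ((start + t : ℝ) * Complex.I)) ''
      Set.Icc 0 (sweep u))
    ((fun t : ℝ => center + radius v * Complex.exp ((start + t : ℝ) * Complex.I)) ''
      Set.Icc 0 (sweep v))

namespace SemiArcRepresentation

/-- The closed circular arc that represents the vertex `v`. -/
def arc {V : Type*} (R : SemiArcRepresentation V) (v : V) : Set ℂ :=
  (fun t : ℝ => R.center + R.radius v * Complex.exp ((R.start + t : ℝ) * Complex.I)) ''
    Set.Icc 0 (R.sweep v)

/-- The arcs of `u` and `v` are joined by a line of sight that meets at most `k` further arcs. A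
line of sight is a segment on a line through the center (possibly passing through the center), with
one end on each of the two arcs. An arc that it meets twice is counted once. -/
def Sees {V : Type*} (R : SemiArcRepresentation V) (k : ℕ) (u v : V) : Prop :=
  ∃ p ∈ R.arc u, ∃ q ∈ R.arc v, Collinear ℝ {R.center, p, q} ∧
    {w : V | w ≠ u ∧ w ≠ v ∧ (segment ℝ p q ∩ R.arc w).Nonempty}.encard ≤ k

theorem Sees.symm {V : Type*} {R : SemiArcRepresentation V} {k : ℕ} {u v : V}
    (h : R.Sees k u v) : R.Sees k v u := by
  obtain ⟨p, hp, q, hq, hc, hk⟩ := h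
  refine ⟨q, hq, p, hp, ?_, ?_⟩
  · rwa [Set.pair_comm q p]
  · rw [segment_symm ℝ q p]
    refine le_trans (le_of_eq ?_) hk
    congr 1
    ext w
    exact and_left_comm

/-- The `k`-visibility graph of a semi-arc representation. -/
def visibilityGraph {V : Type*} (R : SemiArcRepresentation V) (k : ℕ) : SimpleGraph V where
  Adj u v := u ≠ v ∧ R.Sees k u v
  symm := ⟨fun _ _ h => ⟨h.1.symm, h.2.symm⟩⟩
  loopless := ⟨fun _ h => h.1 rfl⟩

end SemiArcRepresentation

/-- `G` is a semi-arc `k`-visibility graph. -/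
def IsSemiArcVisibilityGraph {V : Type*} (k : ℕ) (G : SimpleGraph V) : Prop :=
  ∃ R : SemiArcRepresentation V, R.visibilityGraph k = G

/-- `S` is a simple (non-self-intersecting) arc in the plane with end points `a` and `b`. -/
def IsSimpleArc (a b : ℂ) (S : Set ℂ) : Prop :=
  ∃ γ : Path a b, Function.Injective γ ∧ Set.range γ = S

/-- `G` can be drawn in the plane: vertices go to distinct points and edges to simple arcs joining
their end points; an edge passes through no vertex other than its ends, and two distinct edges
meet only at common end points. -/
def IsPlanarGraph {V : Type*} (G : SimpleGraph V) : Prop :=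
  ∃ (pos : V → ℂ) (drawing : Sym2 V → Set ℂ),
    Function.Injective pos ∧
    (∀ u v, G.Adj u v → IsSimpleArc (pos u) (pos v) (drawing s(u, v))) ∧
    (∀ e ∈ G.edgeSet, ∀ w, pos w ∈ drawing e → w ∈ e) ∧
    (∀ e ∈ G.edgeSet, ∀ f ∈ G.edgeSet, e ≠ f →
      drawing e ∩ drawing f ⊆ pos '' {w | w ∈ e ∧ w ∈ f})

/-- The edges of `G` can be partitioned into the edge sets of `t` planar graphs (some of which may
have no edges). -/
def HasPlanarPartition {V : Type*} (G : SimpleGraph V) (t : ℕ) : Prop :=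
  ∃ H : Fin t → SimpleGraph V,
    (∀ i, IsPlanarGraph (H i)) ∧
    (∀ i j, i ≠ j → Disjoint (H i).edgeSet (H j).edgeSet) ∧
    (⋃ i, (H i).edgeSet) = G.edgeSet

/-- The thickness of `G`: the least number of planar graphs into which the edges of `G` can be
partitioned (`⊤` if there is no such finite number). -/
noncomputable def graphThickness {V : Type*} (G : SimpleGraph V) : ℕ∞ :=
  ⨅ (t : ℕ) (_ : HasPlanarPartition G t), (t : ℕ∞)

/-! All arcs start on one ray, so turning a line of sight counterclockwise about the center can only
remove arcs from it. Turn the line of an edge until it reaches the tip of one of its two ends, say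
`w`. The other end is then one of the first `k + 1` arcs met from that tip, going either outwards
(`outerArcs`) or inwards and on through the center (`innerArcs`). This puts every edge into one of
`2(k + 1)` classes, given by a direction and an index `j ≤ k`.

In one class each arc `w` selects at most one partner, so the class lies in the graph of a function
`V → V`. Its components have at most one cycle each, so it is planar
(`isPlanarGraph_functionalGraph`). The two classes with `j = 0` come from unobstructed lines of
sight and both lie in `innermostGraph`, which is planar as a whole (`isPlanarGraph_innermostGraph`).
Hence `2k + 1` planar graphs cover all edges.

Both planarity proofs place the vertices on the real line and draw edges with parabolic arches above
and below it, which reduces planarity to inequalities between real numbers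
(`IsPlanarGraph.of_doubleArch`). -/

/-! ### Simple arcs, and drawings made of parabolic arches over a line. -/

theorem IsSimpleArc.symm {a b : ℂ} {S : Set ℂ} (h : IsSimpleArc a b S) : IsSimpleArc b a S := by
  obtain ⟨γ, hγ, hS⟩ := h
  refine ⟨γ.symm, fun x y hxy => ?_, by rw [Path.symm_range, hS]⟩
  simpa using hγ (by simpa using hxy : γ (unitInterval.symm x) = γ (unitInterval.symm y))

theorem IsSimpleArc.trans {a b c : ℂ} {S T : Set ℂ} (hS : IsSimpleArc a b S)
    (hT : IsSimpleArc b c T) (h : S ∩ T ⊆ {b}) : IsSimpleArc a c (S ∪ T) := by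
  obtain ⟨γ, hγ, rfl⟩ := hS
  obtain ⟨δ, hδ, rfl⟩ := hT
  refine ⟨γ.trans δ, ?_, Path.trans_range γ δ⟩
  have key : ∀ x y : unitInterval, (x : ℝ) ≤ 1 / 2 → ¬ (y : ℝ) ≤ 1 / 2 →
      γ.trans δ x ≠ γ.trans δ y := by
    intro x y hx hy hxy
    rw [Path.trans_apply, Path.trans_apply, dif_pos hx, dif_neg hy] at hxy
    have hb := h ⟨⟨_, rfl⟩, ⟨_, hxy.symm⟩⟩
    rw [Set.mem_singleton_iff, hxy] at hb
    have := congrArg Subtype.val (hδ (hb.trans δ.source.symm))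
    simp only [Set.Icc.coe_zero] at this
    apply hy
    linarith
  intro x y hxy
  by_cases hx : (x : ℝ) ≤ 1 / 2 <;> by_cases hy : (y : ℝ) ≤ 1 / 2
  · rw [Path.trans_apply, Path.trans_apply, dif_pos hx, dif_pos hy] at hxy
    have := congrArg Subtype.val (hγ hxy)
    ext
    simp only at this
    linarith
  · exact (key x y hx hy hxy).elim
  · exact (key y x hy hx hxy.symm).elim
  · rw [Path.trans_apply, Path.trans_apply, dif_neg hx, dif_neg hy] at hxy
    have := congrArg Subtype.val (hδ hxy)
    ext
    simp only at this
    linarith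

theorem IsPlanarGraph.mono {V : Type*} {G H : SimpleGraph V} (hG : IsPlanarGraph G) (h : H ≤ G) :
    IsPlanarGraph H := by
  obtain ⟨pos, D, h1, h2, h3, h4⟩ := hG
  have hE := SimpleGraph.edgeSet_mono h
  exact ⟨pos, D, h1, fun u v huv => h2 u v (h huv), fun e he => h3 e (hE he),
    fun e he f hf => h4 e (hE he) f (hE hf)⟩

/-- The parabolic arch over the real interval between `a` and `b`; it lies in the upper half plane
for `σ = 1` and in the lower half plane for `σ = -1`. -/
def arch (σ a b : ℝ) : Set ℂ :=
  (fun x : ℝ => (⟨x, σ * ((x - a) * (b - x))⟩ : ℂ)) '' Set.uIcc a b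

theorem arch_self (σ a : ℝ) : arch σ a a = {(a : ℂ)} := by
  simp only [arch, Set.uIcc_self, Set.image_singleton, sub_self, mul_zero]
  rfl

theorem left_mem_arch (σ a b : ℝ) : (a : ℂ) ∈ arch σ a b :=
  ⟨a, Set.left_mem_uIcc, by simp [Complex.ext_iff]⟩

theorem right_mem_arch (σ a b : ℝ) : (b : ℂ) ∈ arch σ a b :=
  ⟨b, Set.right_mem_uIcc, by simp [Complex.ext_iff]⟩

theorem isSimpleArc_arch (σ : ℝ) {a b : ℝ} (h : a ≠ b) : IsSimpleArc a b (arch σ a b) := by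
  have hab : b - a ≠ 0 := sub_ne_zero.2 h.symm
  let F : ℝ → ℂ := fun x => ⟨x, σ * ((x - a) * (b - x))⟩
  have hF : Continuous F := by
    have : F = fun x : ℝ => (x : ℂ) + ((σ * ((x - a) * (b - x)) : ℝ) : ℂ) * Complex.I := by
      funext x
      simp [F, Complex.ext_iff]
    rw [this]
    fun_prop
  have hFinj : Function.Injective F := fun x y hxy => congrArg Complex.re hxy
  refine ⟨⟨⟨fun t => F (a + t * (b - a)), by fun_prop⟩, by simp [F, Complex.ext_iff],
    by simp [F, Complex.ext_iff]⟩, fun s t hst => ?_, ?_⟩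
  · have := hFinj hst
    ext
    exact mul_right_cancel₀ hab (add_left_cancel this)
  · rw [arch, ← segment_eq_uIcc, segment_eq_image', Set.image_image]
    ext z
    constructor
    · rintro ⟨t, rfl⟩
      exact ⟨t, t.2, by simp [F]⟩
    · rintro ⟨t, ht, rfl⟩
      exact ⟨⟨t, ht⟩, by simp [F]⟩

theorem arch_height_nonneg {a b x : ℝ} (hx : x ∈ Set.uIcc a b) : 0 ≤ (x - a) * (b - x) := by
  rcases Set.mem_uIcc.1 hx with h | h <;> nlinarith [h.1, h.2]

theorem eq_or_eq_of_mem_arch {σ a b x : ℝ} (hσ : σ ≠ 0) (h : (x : ℂ) ∈ arch σ a b) :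
    x = a ∨ x = b := by
  obtain ⟨y, -, hy⟩ := h
  have h1 : y = x := congrArg Complex.re hy
  have h2 : σ * ((y - a) * (b - y)) = 0 := congrArg Complex.im hy
  subst h1
  rcases mul_eq_zero.1 ((mul_eq_zero.1 h2).resolve_left hσ) with h | h
  · exact Or.inl (sub_eq_zero.1 h)
  · exact Or.inr (sub_eq_zero.1 h).symm

/-- The arches over the intervals between `a` and `b` and between `c` and `d` do not meet above
common interior points. -/
def ArchesAvoid (a b c d : ℝ) : Prop :=
  ∀ x, x ∈ Set.Ioo (min a b) (max a b) → x ∈ Set.Ioo (min c d) (max c d) →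
    (x - a) * (b - x) ≠ (x - c) * (d - x)

theorem ArchesAvoid.symm {a b c d : ℝ} (h : ArchesAvoid a b c d) : ArchesAvoid c d a b :=
  fun x h1 h2 h3 => h x h2 h1 h3.symm

theorem archesAvoid_self_left (a c d : ℝ) : ArchesAvoid a a c d := by
  intro x hx
  simp at hx

theorem archesAvoid_self_right (a b c : ℝ) : ArchesAvoid a b c c :=
  (archesAvoid_self_left c a b).symm

theorem archesAvoid_of_disjoint {a b c d : ℝ} (h : max a b ≤ min c d) : ArchesAvoid a b c d := by
  intro x hx hx'
  exact absurd (hx.2.trans_le h) (not_lt.2 hx'.1.le)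

/-- All parabolas have the same leading coefficient, so over the inner interval the parabola of a
strictly larger interval is strictly higher, even when the two share a foot. -/
theorem archesAvoid_of_nested {a b c d : ℝ} (hac : a ≤ c) (hcd : c ≤ d) (hdb : d ≤ b)
    (hne : a ≠ c ∨ d ≠ b) : ArchesAvoid a b c d := by
  intro x hx hx'
  rw [min_eq_left hcd, max_eq_right hcd] at hx'
  obtain ⟨h1, h2⟩ := hx'
  rcases hne with h | h
  · have := lt_of_le_of_ne hac h
    nlinarith
  · have := lt_of_le_of_ne hdb h
    nlinarith

/-- A point with imaginary part zero on an arch is one of its feet. -/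
theorem spine_of_im_eq_zero {σ a b : ℝ} (hσ : σ ≠ 0) {z : ℂ} (hz : z ∈ arch σ a b)
    (h : z.im = 0) : z = (z.re : ℂ) ∧ (z.re = a ∨ z.re = b) := by
  have e : z = (z.re : ℂ) := by simp [Complex.ext_iff, h]
  exact ⟨e, eq_or_eq_of_mem_arch hσ (e ▸ hz)⟩

theorem im_eq_zero_of_mem_arch_inter {σ a b c d : ℝ} (h : ArchesAvoid a b c d) (hσ : σ ≠ 0)
    {z : ℂ} (h1 : z ∈ arch σ a b) (h2 : z ∈ arch σ c d) : z.im = 0 := by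
  obtain ⟨x, hx, rfl⟩ := h1
  obtain ⟨y, hy, hxy⟩ := h2
  obtain rfl : y = x := congrArg Complex.re hxy
  have e : σ * ((y - c) * (d - y)) = σ * ((y - a) * (b - y)) := congrArg Complex.im hxy
  show σ * ((y - a) * (b - y)) = 0
  by_contra hne
  have hne' := hne
  rw [← e] at hne'
  have interior : ∀ {p q : ℝ}, y ∈ Set.uIcc p q → σ * ((y - p) * (q - y)) ≠ 0 →
      y ∈ Set.Ioo (min p q) (max p q) := by
    intro p q hpq hn
    have n1 : y ≠ p := by rintro rfl; simp at hn
    have n2 : y ≠ q := by rintro rfl; simp at hn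
    refine ⟨lt_of_le_of_ne hpq.1 ?_, lt_of_le_of_ne hpq.2 ?_⟩
    · rcases min_choice p q with h | h <;> rw [h] <;> first | exact n1.symm | exact n2.symm
    · rcases max_choice p q with h | h <;> rw [h] <;> assumption
  exact h y (interior hx hne) (interior hy hne') (mul_left_cancel₀ hσ e).symm

theorem im_eq_zero_of_mem_arch_opposite {a b c d : ℝ} {z : ℂ} (h1 : z ∈ arch (-1) a b)
    (h2 : z ∈ arch 1 c d) : z.im = 0 := by
  obtain ⟨x, hx, rfl⟩ := h1
  obtain ⟨y, hy, hxy⟩ := h2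
  have e : 1 * ((y - c) * (d - y)) = -1 * ((x - a) * (b - x)) := congrArg Complex.im hxy
  have := arch_height_nonneg hx
  have := arch_height_nonneg hy
  show -1 * ((x - a) * (b - x)) = 0
  linarith

/-- The curve that runs below the real line from `a` to `m` and then above it from `m` to `b`. -/
def doubleArch (a m b : ℝ) : Set ℂ :=
  arch (-1) a m ∪ arch 1 m b

theorem isSimpleArc_doubleArch {a b : ℝ} (m : ℝ) (h : a ≠ b) :
    IsSimpleArc a b (doubleArch a m b) := by
  unfold doubleArch
  rcases eq_or_ne a m with rfl | ha
  · rw [arch_self, Set.union_eq_self_of_subset_left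
      (Set.singleton_subset_iff.2 (left_mem_arch 1 a b))]
    exact isSimpleArc_arch 1 h
  rcases eq_or_ne m b with rfl | hb
  · rw [arch_self, Set.union_eq_self_of_subset_right
      (Set.singleton_subset_iff.2 (right_mem_arch (-1) a m))]
    exact isSimpleArc_arch (-1) h
  refine (isSimpleArc_arch (-1) ha).trans (isSimpleArc_arch 1 hb) ?_
  rintro z ⟨h1, h2⟩
  have h0 := im_eq_zero_of_mem_arch_opposite h1 h2
  obtain ⟨e, h3⟩ := spine_of_im_eq_zero (by norm_num) h1 h0
  obtain ⟨-, h4⟩ := spine_of_im_eq_zero one_ne_zero h2 h0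
  have : z.re = m := by
    rcases h3 with h3 | h3
    · rcases h4 with h4 | h4
      · exact h4
      · exact absurd (h3.symm.trans h4) h
    · exact h3
  rw [Set.mem_singleton_iff, e, this]

theorem spine_of_mem_doubleArch {a m b : ℝ} {z : ℂ} (hz : z ∈ doubleArch a m b) (h : z.im = 0) :
    z = (z.re : ℂ) ∧ (z.re = a ∨ z.re = m ∨ z.re = b) := by
  rcases hz with hz | hz
  · obtain ⟨e, h | h⟩ := spine_of_im_eq_zero (by norm_num) hz h
    exacts [⟨e, Or.inl h⟩, ⟨e, Or.inr (Or.inl h)⟩]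
  · obtain ⟨e, h | h⟩ := spine_of_im_eq_zero one_ne_zero hz h
    exacts [⟨e, Or.inr (Or.inl h)⟩, ⟨e, Or.inr (Or.inr h)⟩]

theorem im_eq_zero_of_mem_doubleArch_inter {a m b a' m' b' : ℝ} {z : ℂ}
    (h1 : ArchesAvoid a m a' m') (h2 : ArchesAvoid m b m' b')
    (hz : z ∈ doubleArch a m b) (hz' : z ∈ doubleArch a' m' b') : z.im = 0 := by
  rcases hz with hz | hz <;> rcases hz' with hz' | hz'
  · exact im_eq_zero_of_mem_arch_inter h1 (by norm_num) hz hz'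
  · exact im_eq_zero_of_mem_arch_opposite hz hz'
  · exact im_eq_zero_of_mem_arch_opposite hz' hz
  · exact im_eq_zero_of_mem_arch_inter h2 one_ne_zero hz hz'

/-- A graph is planar if it has a drawing with its vertices on the real line and with edges that
consist of an arch below the line and an arch above it. -/
theorem IsPlanarGraph.of_doubleArch {V : Type*} (G : SimpleGraph V) (pos : V → ℝ)
    (hpos : Function.Injective pos) (mid : V → V → ℝ)
    (hvert : ∀ u v, G.Adj u v → pos u < pos v → ∀ w, mid u v = pos w → w = u ∨ w = v)
    (hmid : ∀ u v u' v', G.Adj u v → pos u < pos v → G.Adj u' v' → pos u' < pos v' →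
      mid u v = mid u' v' → (u = u' ∧ v = v') ∨ ∃ w, mid u v = pos w)
    (havoid : ∀ u v u' v', G.Adj u v → pos u < pos v → G.Adj u' v' → pos u' < pos v' →
      (u, v) ≠ (u', v') → ArchesAvoid (pos u) (mid u v) (pos u') (mid u' v') ∧
        ArchesAvoid (mid u v) (pos v) (mid u' v') (pos v')) :
    IsPlanarGraph G := by
  -- An edge is drawn from its left end to its right end. The union over orientations has one
  -- nonempty term, because only one orientation increases `pos`.
  let D : Sym2 V → Set ℂ := fun e =>
    {z | ∃ u v, e = s(u, v) ∧ pos u < pos v ∧ z ∈ doubleArch (pos u) (mid u v) (pos v)}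
  have hD : ∀ u v, pos u < pos v → D s(u, v) = doubleArch (pos u) (mid u v) (pos v) := by
    intro u v huv
    ext z
    constructor
    · rintro ⟨u', v', he, hlt, hz⟩
      rcases Sym2.eq_iff.1 he with ⟨rfl, rfl⟩ | ⟨rfl, rfl⟩
      · exact hz
      · exact absurd hlt huv.le.not_gt
    · exact fun hz => ⟨u, v, rfl, huv, hz⟩
  have horient : ∀ e ∈ G.edgeSet, ∃ u v, e = s(u, v) ∧ G.Adj u v ∧ pos u < pos v := by
    intro e he
    induction e with
    | _ u v =>
      have huv : G.Adj u v := he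
      rcases lt_or_gt_of_ne (fun h => huv.ne (hpos h)) with h | h
      · exact ⟨u, v, rfl, huv, h⟩
      · exact ⟨v, u, Sym2.eq_swap, huv.symm, h⟩
  have hspine : ∀ u v, G.Adj u v → pos u < pos v → ∀ w,
      (pos w = pos u ∨ pos w = mid u v ∨ pos w = pos v) → w ∈ s(u, v) := by
    intro u v huv hlt w hw
    rw [Sym2.mem_iff]
    rcases hw with h | h | h
    · exact Or.inl (hpos h)
    · exact hvert u v huv hlt w h.symm
    · exact Or.inr (hpos h)
  refine ⟨fun v => (pos v : ℂ), D, fun u v h => hpos (Complex.ofReal_injective h), ?_, ?_, ?_⟩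
  · intro u v huv
    rcases lt_or_gt_of_ne (fun h => huv.ne (hpos h)) with h | h
    · rw [hD u v h]
      exact isSimpleArc_doubleArch _ h.ne
    · rw [Sym2.eq_swap, hD v u h]
      exact (isSimpleArc_doubleArch _ h.ne).symm
  · intro e he w hw
    obtain ⟨u, v, rfl, huv, hlt⟩ := horient e he
    rw [hD u v hlt] at hw
    exact hspine u v huv hlt w (spine_of_mem_doubleArch hw (Complex.ofReal_im _)).2
  · rintro e he f hf hef z ⟨hz, hz'⟩
    obtain ⟨u, v, rfl, huv, hlt⟩ := horient e he
    obtain ⟨u', v', rfl, huv', hlt'⟩ := horient f hf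
    rw [hD u v hlt] at hz
    rw [hD u' v' hlt'] at hz'
    have hne : (u, v) ≠ (u', v') := by
      rintro h
      obtain ⟨rfl, rfl⟩ := Prod.mk.inj h
      exact hef rfl
    obtain ⟨hav, hav'⟩ := havoid u v u' v' huv hlt huv' hlt' hne
    have h0 := im_eq_zero_of_mem_doubleArch_inter hav hav' hz hz'
    obtain ⟨e1, s1⟩ := spine_of_mem_doubleArch hz h0
    obtain ⟨-, s2⟩ := spine_of_mem_doubleArch hz' h0
    suffices ∃ w, z.re = pos w by
      obtain ⟨w, hw⟩ := this
      rw [hw] at s1 s2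
      exact ⟨w, ⟨hspine u v huv hlt w s1, hspine u' v' huv' hlt' w s2⟩, by rw [e1, hw]⟩
    rcases s1 with h | h | h
    · exact ⟨u, h⟩
    · rcases s2 with h' | h' | h'
      · exact ⟨u', h'⟩
      · rcases hmid u v u' v' huv hlt huv' hlt' (h.symm.trans h') with ⟨rfl, rfl⟩ | ⟨w, hw⟩
        · exact absurd rfl hne
        · exact ⟨w, h.trans hw⟩
      · exact ⟨v', h'⟩
    · exact ⟨v, h⟩

/-- A graph is planar if its vertices can be ordered on a line so that no two edges cross. -/
theorem IsPlanarGraph.of_noncrossing {V : Type*} (G : SimpleGraph V) (pos : V → ℝ)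
    (hpos : Function.Injective pos)
    (hnc : ∀ a b c d, G.Adj a c → G.Adj b d → pos a < pos b → pos b < pos c → pos c < pos d →
      False) :
    IsPlanarGraph G := by
  -- With the midpoint at the left end the lower arch shrinks to a point, so every edge is drawn
  -- above the line.
  refine IsPlanarGraph.of_doubleArch G pos hpos (fun u _ => pos u)
    (fun u v _ _ w h => Or.inl (hpos h.symm)) (fun u v _ _ _ _ _ _ _ => Or.inr ⟨u, rfl⟩) ?_
  intro u v u' v' huv hlt huv' hlt' hne
  refine ⟨archesAvoid_self_left _ _ _, ?_⟩
  rcases le_or_gt (pos v) (pos u') with h1 | h1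
  · exact archesAvoid_of_disjoint (by simp [hlt.le, hlt'.le, h1])
  rcases le_or_gt (pos v') (pos u) with h2 | h2
  · exact (archesAvoid_of_disjoint (by simp [hlt.le, hlt'.le, h2])).symm
  have hne' : pos u ≠ pos u' ∨ pos v' ≠ pos v := by
    by_contra! h
    exact hne (Prod.ext (hpos h.1) (hpos h.2.symm))
  rcases lt_trichotomy (pos u) (pos u') with h3 | h3 | h3
  · have : pos v' ≤ pos v := not_lt.1 fun h => hnc u u' v v' huv huv' h3 h1 h
    exact archesAvoid_of_nested h3.le hlt'.le this hne'
  · rcases le_total (pos v') (pos v) with h4 | h4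
    · exact archesAvoid_of_nested h3.le hlt'.le h4 hne'
    · exact (archesAvoid_of_nested h3.ge hlt.le h4 (hne'.imp Ne.symm Ne.symm)).symm
  · have : pos v ≤ pos v' := not_lt.1 fun h => hnc u' u v' v huv' huv h3 h2 h
    exact (archesAvoid_of_nested h3.le hlt.le this (hne'.imp Ne.symm Ne.symm)).symm

/-! ### From covers by planar graphs to thickness. -/

/-- It suffices to cover the edges of a graph by planar graphs to bound its thickness. -/
theorem graphThickness_le_of_cover {V : Type*} {G : SimpleGraph V} {t : ℕ}
    (C : Fin t → SimpleGraph V) (hC : ∀ i, IsPlanarGraph (C i))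
    (hcov : ∀ u v, G.Adj u v → ∃ i, (C i).Adj u v) : graphThickness G ≤ t := by
  -- Each edge is kept only in the first graph of the cover that contains it, which makes the edge
  -- sets disjoint.
  let H : Fin t → SimpleGraph V := fun i =>
    { Adj := fun u v => G.Adj u v ∧ (C i).Adj u v ∧ ∀ j < i, ¬ (C j).Adj u v
      symm := ⟨fun _ _ h => ⟨h.1.symm, h.2.1.symm, fun j hj h' => h.2.2 j hj h'.symm⟩⟩
      loopless := ⟨fun _ h => h.1.ne rfl⟩ }
  refine iInf₂_le t ⟨H, fun i => (hC i).mono fun u v h => h.2.1, ?_, ?_⟩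
  · intro i j hij
    rw [Set.disjoint_left]
    intro e hi hj
    induction e with
    | _ u v =>
      have hi' : (H i).Adj u v := hi
      have hj' : (H j).Adj u v := hj
      rcases lt_or_gt_of_ne hij with h | h
      · exact hj'.2.2 i h hi'.2.1
      · exact hi'.2.2 j h hj'.2.1
  · ext e
    induction e with
    | _ u v =>
      simp only [Set.mem_iUnion, SimpleGraph.mem_edgeSet]
      constructor
      · rintro ⟨i, hi⟩
        exact hi.1
      · intro h
        classical
        obtain ⟨i, hi⟩ := hcov u v h
        have hne : (Finset.univ.filter fun i => (C i).Adj u v).Nonempty := ⟨i, by simpa using hi⟩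
        refine ⟨_, h, by simpa using Finset.min'_mem _ hne, fun j hj hadj => ?_⟩
        exact absurd (Finset.min'_le _ j (by simpa using hadj)) (not_le.2 hj)

/-! ### Planarity of functional graphs. -/

/-- The simple graph that joins each vertex to its image under `f`. -/
def functionalGraph {V : Type*} (f : V → V) : SimpleGraph V where
  Adj u v := u ≠ v ∧ (f u = v ∨ f v = u)
  symm := ⟨fun _ _ h => ⟨h.1.symm, h.2.symm⟩⟩
  loopless := ⟨fun _ h => h.1 rfl⟩

/-- The vertices in `S` are placed on the line so that the edges of the functional graph of `f`
between them do not cross. -/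
structure IsNoncrossingOn {V : Type*} (f : V → V) (S : Set V) (pos : V → ℝ) : Prop where
  mapsTo : Set.MapsTo f S S
  injOn : Set.InjOn pos S
  noncrossing : ∀ a ∈ S, ∀ b ∈ S, ∀ c ∈ S, ∀ d ∈ S, (functionalGraph f).Adj a c →
    (functionalGraph f).Adj b d → pos a < pos b → pos b < pos c → pos c < pos d → False

/-- A vertex that `f` maps into the placed set can be placed next to its image. -/
theorem IsNoncrossingOn.exists_insert {V : Type*} [Finite V] {f : V → V} {S : Set V} {pos : V → ℝ}
    (h : IsNoncrossingOn f S pos) {y : V} (hy : y ∉ S) (hfy : f y ∈ S) :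
    ∃ pos', IsNoncrossingOn f (insert y S) pos' := by
  classical
  -- The place `q` for `y` is so close to the right of `f y` that no vertex lies between. Since `f`
  -- preserves `S`, the only neighbour of `y` in `S` is `f y`, and that edge spans no vertex.
  obtain ⟨q, hq, hgap⟩ : ∃ q, pos (f y) < q ∧ ∀ x, pos (f y) < pos x → q < pos x := by
    have hev : ∀ᶠ q in nhdsWithin (pos (f y)) (Set.Ioi (pos (f y))),
        ∀ x, pos (f y) < pos x → q < pos x := by
      rw [Filter.eventually_all]
      intro x
      by_cases hx : pos (f y) < pos x
      · filter_upwards [Ioo_mem_nhdsGT hx] with q hq _ using hq.2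
      · exact Filter.Eventually.of_forall fun q h => absurd h hx
    obtain ⟨q, h1, h2⟩ := (hev.and self_mem_nhdsWithin).exists
    exact ⟨q, h2, h1⟩
  have hsep : ∀ x, pos x ≠ q := fun x hx => by
    have := hgap x (hx ▸ hq)
    exact this.ne hx.symm
  have hbelow : ∀ x, pos x < q → pos x ≤ pos (f y) := fun x hx =>
    not_lt.1 fun h' => (hgap x h').not_gt hx
  have hpy : Function.update pos y q y = q := Function.update_self ..
  have hpS : ∀ x ∈ S, Function.update pos y q x = pos x := fun x hx =>
    Function.update_of_ne (by rintro rfl; exact hy hx) ..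
  have hadj : ∀ x ∈ S, (functionalGraph f).Adj x y → x = f y := by
    rintro x hx ⟨-, h' | h'⟩
    · exact absurd (h' ▸ h.mapsTo hx) hy
    · exact h'.symm
  refine ⟨Function.update pos y q, ?_, ?_, ?_⟩
  · rintro x (rfl | hx)
    · exact Or.inr hfy
    · exact Or.inr (h.mapsTo hx)
  · rintro a (rfl | ha) b (rfl | hb) hab
    · rfl
    · rw [hpy, hpS b hb] at hab
      exact absurd hab.symm (hsep b)
    · rw [hpy, hpS a ha] at hab
      exact absurd hab (hsep a)
    · rw [hpS a ha, hpS b hb] at hab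
      exact h.injOn ha hb hab
  · intro a ha b hb c hc d hd hac hbd hlt1 hlt2 hlt3
    have key : ∀ x ∈ insert y S, ∀ z ∈ insert y S, Function.update pos y q (f y) <
        Function.update pos y q x → Function.update pos y q x < Function.update pos y q y →
        False := by
      rintro x (rfl | hx) - - h1 h2
      · exact h2.false
      · rw [hpS _ hx, hpy] at h2
        rw [hpS _ hx, hpS _ hfy] at h1
        exact (hgap x h1).not_gt h2
    have key2 : ∀ x ∈ insert y S, Function.update pos y q y < Function.update pos y q x →
        x ∈ S := by
      rintro x (rfl | hx) h1
      · exact absurd h1 (lt_irrefl _)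
      · exact hx
    rcases ha with rfl | ha
    · have hcS := key2 c hc (hlt1.trans hlt2)
      have := hadj c hcS hac.symm
      subst this
      rw [hpS _ hcS, hpy] at *
      linarith
    rcases hc with rfl | hc
    · have := hadj a ha hac
      subst this
      exact key b hb b hb hlt1 hlt2
    rcases hb with rfl | hb
    · have hdS := key2 d hd (hlt2.trans hlt3)
      have := hadj d hdS hbd.symm
      subst this
      rw [hpS _ hdS, hpy] at *
      linarith
    rcases hd with rfl | hd
    · have := hadj b hb hbd
      subst this
      exact key c (Or.inr hc) c (Or.inr hc) hlt2 hlt3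
    rw [hpS a ha, hpS b hb] at hlt1
    rw [hpS b hb, hpS c hc] at hlt2
    rw [hpS c hc, hpS d hd] at hlt3
    exact h.noncrossing a ha b hb c hc d hd hac hbd hlt1 hlt2 hlt3

/-- If `f` maps no further vertex into the placed set, then a whole orbit can be placed to the
right of it. -/
theorem IsNoncrossingOn.exists_union_orbit {V : Type*} [Finite V] {f : V → V} {S : Set V}
    {pos : V → ℝ} (h : IsNoncrossingOn f S pos) (hS : ∀ y ∉ S, f y ∉ S) {x : V} (hx : x ∉ S) :
    ∃ pos', IsNoncrossingOn f (S ∪ Set.range fun n : ℕ => f^[n] x) pos' := by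
  classical
  obtain ⟨M, hM⟩ : ∃ M, ∀ v, pos v < M := by
    obtain ⟨M, hM⟩ := (Set.finite_range pos).bddAbove
    exact ⟨M + 1, fun v => (hM ⟨v, rfl⟩).trans_lt (lt_add_one M)⟩
  set O : Set V := Set.range fun n : ℕ => f^[n] x with hO
  have hOS : ∀ y ∈ O, y ∉ S := by
    rintro y ⟨n, rfl⟩
    induction n with
    | zero => exact hx
    | succ n ih =>
      simp only [Function.iterate_succ_apply']
      exact hS _ ih
  -- The first time at which the orbit reaches `y`; the value off the orbit plays no role.
  let idx : V → ℕ := fun y => if hy : ∃ n : ℕ, f^[n] x = y then Nat.find hy else 0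
  have hidx : ∀ y ∈ O, f^[idx y] x = y := by
    rintro y hy
    have hy' : ∃ n : ℕ, f^[n] x = y := hy
    simp only [idx, dif_pos hy']
    exact Nat.find_spec hy'
  have hmin : ∀ n y, f^[n] x = y → idx y ≤ n := by
    intro n y hy
    have hy' : ∃ n : ℕ, f^[n] x = y := ⟨n, hy⟩
    simp only [idx, dif_pos hy']
    exact Nat.find_min' hy' hy
  have hfO : Set.MapsTo f O O := by
    rintro _ ⟨n, rfl⟩
    exact ⟨n + 1, Function.iterate_succ_apply' f n x⟩
  have hidxf : ∀ y ∈ O, idx (f y) ≤ idx y + 1 := fun y hy =>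
    hmin _ _ (by rw [Function.iterate_succ_apply', hidx y hy])
  -- an edge that goes backwards starts at the last vertex of the orbit
  have hback : ∀ y ∈ O, idx (f y) ≤ idx y → ∀ z ∈ O, idx z ≤ idx y := by
    intro y hy hle
    have : ∀ n : ℕ, idx (f^[n] x) ≤ idx y := by
      intro n
      induction n with
      | zero => exact (hmin 0 _ rfl).trans (Nat.zero_le _)
      | succ n ih =>
        rw [Function.iterate_succ_apply']
        rcases ih.lt_or_eq with hlt | heq
        · exact (hidxf _ ⟨n, rfl⟩).trans hlt
        · have e : f^[idx (f^[n] x)] x = f^[n] x := hidx _ ⟨n, rfl⟩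
          rw [heq, hidx y hy] at e
          exact e ▸ hle
    rintro z ⟨n, rfl⟩
    exact this n
  have hinj : ∀ y ∈ O, ∀ z ∈ O, idx y = idx z → y = z := fun y hy z hz hyz => by
    rw [← hidx y hy, ← hidx z hz, hyz]
  -- The orbit is a path closed up by one backward edge. An edge that skips a vertex must be that
  -- backward edge, so its right end is the last vertex of the orbit and no crossing edge can end
  -- further right.
  have hlong : ∀ y ∈ O, ∀ z ∈ O, (functionalGraph f).Adj y z → idx y + 1 < idx z →
      ∀ w ∈ O, idx w ≤ idx z := by
    rintro y hy z hz ⟨-, e | e⟩ hlt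
    · have := hidxf y hy
      rw [e] at this
      omega
    · exact hback z hz (by rw [e]; omega)
  let pos' : V → ℝ := fun y => if y ∈ O then M + idx y else pos y
  have pO : ∀ y ∈ O, pos' y = M + idx y := fun y hy => if_pos hy
  have pS : ∀ y ∈ S, pos' y = pos y := fun y hy => if_neg fun h' => hOS y h' hy
  have hSO : ∀ y ∈ S, ∀ z ∈ O, pos' y < pos' z := by
    intro y hy z hz
    rw [pS y hy, pO z hz]
    have : (0 : ℝ) ≤ idx z := Nat.cast_nonneg _
    linarith [hM y]
  have hidxlt : ∀ y ∈ O, ∀ z ∈ O, pos' y < pos' z → idx y < idx z := by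
    intro y hy z hz hlt
    rw [pO y hy, pO z hz] at hlt
    exact_mod_cast (add_lt_add_iff_left M).1 hlt
  have hnadj : ∀ y ∈ S, ∀ z ∈ O, ¬ (functionalGraph f).Adj y z := by
    rintro y hy z hz ⟨-, e | e⟩
    · exact hOS z hz (e ▸ h.mapsTo hy)
    · exact hOS y (e ▸ hfO hz) hy
  refine ⟨pos', ?_, ?_, ?_⟩
  · rintro y (hy | hy)
    · exact Or.inl (h.mapsTo hy)
    · exact Or.inr (hfO hy)
  · rintro y (hy | hy) z (hz | hz) hyz
    · rw [pS y hy, pS z hz] at hyz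
      exact h.injOn hy hz hyz
    · exact absurd hyz (hSO y hy z hz).ne
    · exact absurd hyz (hSO z hz y hy).ne'
    · rw [pO y hy, pO z hz] at hyz
      exact hinj y hy z hz (by exact_mod_cast add_left_cancel hyz)
  · rintro a ha b hb c hc d hd hac hbd h1 h2 h3
    rcases hc with hc | hc
    · have ha' : a ∈ S := ha.resolve_right fun h' => hnadj c hc a h' hac.symm
      have hb' : b ∈ S := hb.resolve_right fun h' => (hSO c hc b h').not_gt h2
      have hd' : d ∈ S := hd.resolve_right fun h' => hnadj b hb' d h' hbd
      rw [pS a ha', pS b hb'] at h1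
      rw [pS b hb', pS c hc] at h2
      rw [pS c hc, pS d hd'] at h3
      exact h.noncrossing a ha' b hb' c hc d hd' hac hbd h1 h2 h3
    · have ha' : a ∈ O := ha.resolve_left fun h' => hnadj a h' c hc hac
      have hb' : b ∈ O := hb.resolve_left fun h' => (hSO b h' a ha').not_gt h1
      have hd' : d ∈ O := hd.resolve_left fun h' => hnadj d h' b hb' hbd.symm
      have i1 := hidxlt a ha' b hb' h1
      have i2 := hidxlt b hb' c hc h2
      have i3 := hidxlt c hc d hd' h3
      have := hlong a ha' c hc hac (by omega) d hd'
      omega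

/-- A maximal set with a noncrossing placement is everything: otherwise either some outside vertex
maps into it and can be inserted, or the orbit of an outside vertex avoids it and can be appended.
-/
theorem isPlanarGraph_functionalGraph {V : Type*} [Finite V] (f : V → V) :
    IsPlanarGraph (functionalGraph f) := by
  have hne : {S : Set V | ∃ pos, IsNoncrossingOn f S pos}.Nonempty :=
    ⟨∅, fun _ => 0, by simp [Set.MapsTo], by simp, by simp⟩
  obtain ⟨S, hS⟩ := (Set.toFinite {S : Set V | ∃ pos, IsNoncrossingOn f S pos}).exists_maximal hne
  obtain ⟨pos, hpos⟩ := hS.prop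
  have huniv : ∀ x, x ∈ S := by
    by_contra! hx
    obtain ⟨x, hx⟩ := hx
    by_cases hcl : ∃ y, y ∉ S ∧ f y ∈ S
    · obtain ⟨y, hy, hfy⟩ := hcl
      exact hy (hS.le_of_ge (hpos.exists_insert hy hfy) (Set.subset_insert y S)
        (Set.mem_insert y S))
    · push Not at hcl
      exact hx (hS.le_of_ge (hpos.exists_union_orbit hcl hx) Set.subset_union_left
        (Or.inr ⟨0, rfl⟩))
  exact IsPlanarGraph.of_noncrossing _ pos (fun a b h => hpos.injOn (huniv a) (huniv b) h)
    fun a b c d => hpos.noncrossing a (huniv a) b (huniv b) c (huniv c) d (huniv d)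

/-! ### Planarity of the graph of unobstructed lines of sight. -/

section InnermostGraph

variable {V : Type*} (r s : V → ℝ)

/-- All arcs with radius strictly between those of `u` and `v` are shorter than both. -/
def NearVisible (u v : V) : Prop :=
  ∀ x, (r u < r x ∧ r x < r v ∨ r v < r x ∧ r x < r u) → s x < s u ∧ s x < s v

/-- On some line through the center, `u` and `v` are the innermost arcs on the two sides. -/
def CenterVisible (u v : V) : Prop :=
  ∃ θ, 0 ≤ θ ∧ θ ≤ s u ∧ θ + Real.pi ≤ s v ∧ θ ≤ Real.pi ∧ (∀ x, θ ≤ s x → r u ≤ r x) ∧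
    ∀ x, θ + Real.pi ≤ s x → r v ≤ r x

variable {r s}

theorem NearVisible.symm {u v : V} (h : NearVisible r s u v) : NearVisible r s v u :=
  fun x hx => (h x hx.symm).symm

theorem CenterVisible.radius_le {u v : V} (h : CenterVisible r s u v) {x : V}
    (hx : Real.pi ≤ s x) : r u ≤ r x := by
  obtain ⟨θ, -, -, -, hθ, h1, -⟩ := h
  exact h1 x (hθ.trans hx)

theorem CenterVisible.pi_le {u v : V} (h : CenterVisible r s u v) : Real.pi ≤ s v := by
  obtain ⟨θ, h0, -, h1, -⟩ := h
  linarith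

/-- Lines of sight through the center move outwards on both sides as they turn. -/
theorem CenterVisible.monotone {u v u' v' : V} (h : CenterVisible r s u v)
    (h' : CenterVisible r s u' v') : r u ≤ r u' ∧ r v ≤ r v' ∨ r u' ≤ r u ∧ r v' ≤ r v := by
  obtain ⟨θ, -, h1, h2, -, h3, h4⟩ := h
  obtain ⟨θ', -, h1', h2', -, h3', h4'⟩ := h'
  rcases le_total θ θ' with hle | hle
  · exact Or.inl ⟨h3 _ (hle.trans h1'), h4 _ (by linarith)⟩
  · exact Or.inr ⟨h3' _ (hle.trans h1), h4' _ (by linarith)⟩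

variable (r s)

/-- The graph of the lines of sight that meet no further arc. -/
def innermostGraph : SimpleGraph V where
  Adj u v := u ≠ v ∧ (NearVisible r s u v ∨ CenterVisible r s u v ∨ CenterVisible r s v u)
  symm := ⟨fun _ _ h => ⟨h.1.symm, h.2.imp NearVisible.symm Or.symm⟩⟩
  loopless := ⟨fun _ h => h.1 rfl⟩

variable {r s}

/-- Each edge makes the inner arc of its span shorter than its ends, so crossing edges would make
`b` shorter than `c` and `c` shorter than `b`. -/
theorem NearVisible.not_cross {a b c d : V} (hac : NearVisible r s a c)
    (hbd : NearVisible r s b d) (h1 : r a < r b) (h2 : r b < r c) (h3 : r c < r d) : False :=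
  lt_asymm (hac b (Or.inl ⟨h1, h2⟩)).2 (hbd c (Or.inl ⟨h2, h3⟩)).1

theorem NearVisible.archesAvoid {a b c d : V} (hr : Function.Injective r)
    (hab : NearVisible r s a b) (hcd : NearVisible r s c d) (h1 : r a < r b) (h2 : r c < r d)
    (hne : (a, b) ≠ (c, d)) : ArchesAvoid (r a) (r b) (r c) (r d) := by
  rcases le_or_gt (r b) (r c) with h3 | h3
  · exact archesAvoid_of_disjoint (by simp [h1.le, h2.le, h3])
  rcases le_or_gt (r d) (r a) with h4 | h4
  · exact (archesAvoid_of_disjoint (by simp [h1.le, h2.le, h4])).symm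
  have hne' : r a ≠ r c ∨ r d ≠ r b := by
    by_contra! h
    exact hne (Prod.ext (hr h.1) (hr h.2.symm))
  have hne'' := hne'.imp Ne.symm Ne.symm
  rcases lt_trichotomy (r a) (r c) with h5 | h5 | h5
  · exact archesAvoid_of_nested h5.le h2.le (not_lt.1 fun h => hab.not_cross hcd h5 h3 h) hne'
  · rcases le_total (r d) (r b) with h6 | h6
    · exact archesAvoid_of_nested h5.le h2.le h6 hne'
    · exact (archesAvoid_of_nested h5.ge h1.le h6 hne'').symm
  · exact (archesAvoid_of_nested h5.le h1.le (not_lt.1 fun h => hcd.not_cross hab h5 h4 h)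
      hne'').symm

theorem archesAvoid_swap {a b c d : ℝ} (h : ArchesAvoid a b c d) : ArchesAvoid b a d c := by
  intro x hx hx'
  rw [min_comm, max_comm] at hx hx'
  have := h x hx hx'
  intro e
  apply this
  linarith

/-- Arc `v` is placed at the point `r v` of the positive axis. Near-visible edges never cross each
other, on whichever side they are drawn. Edges through the center go below the line to a negative
point and return above it; by `CenterVisible.monotone` they are nested around each other on both
sides. It remains to choose sides for near-visible edges so that they avoid these. -/
theorem isPlanarGraph_innermostGraph (hr : Function.Injective r) (hpos : ∀ v, 0 < r v) :
    IsPlanarGraph (innermostGraph r s) := by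
  classical
  let Inner : V → Prop := fun v => ∀ x, Real.pi ≤ s x → r v ≤ r x
  -- For `r u < r v`, the value `r u` draws the edge wholly above the line and `r v` wholly below
  -- it. The value `-(r u + r v)` holds no vertex, and by monotonicity it differs for different
  -- edges through the center.
  let mid : V → V → ℝ := fun u v =>
    if NearVisible r s u v then (if Inner v then r u else r v) else -(r u + r v)
  have hcases : ∀ u v, (innermostGraph r s).Adj u v → r u < r v →
      (NearVisible r s u v ∧ Inner v ∧ mid u v = r u) ∨
      (NearVisible r s u v ∧ ¬ Inner v ∧ mid u v = r v) ∨
      (CenterVisible r s u v ∧ mid u v = -(r u + r v)) := by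
    intro u v huv hlt
    by_cases hn : NearVisible r s u v
    · by_cases hi : Inner v
      · exact Or.inl ⟨hn, hi, by simp [mid, hn, hi]⟩
      · exact Or.inr (Or.inl ⟨hn, hi, by simp [mid, hn, hi]⟩)
    · refine Or.inr (Or.inr ⟨?_, by simp [mid, hn]⟩)
      refine (huv.2.resolve_left hn).resolve_right fun h => ?_
      exact (h.radius_le (x := u) (by have := h.pi_le; exact this)).not_gt hlt
  -- If `r u < r a`, an arc `x` that reaches the angle `π` inside `v` would lie between `u` and `v`.
  -- Then `u` is longer than `x` and also reaches `π`, whence `r a ≤ r u`. So near-visible edges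
  -- drawn below lie to the right of all lower arches of center edges.
  have houter : ∀ u v, NearVisible r s u v → ¬ Inner v → r u < r v → ∀ a b,
      CenterVisible r s a b → r a ≤ r u := by
    intro u v hn hi hlt a b hab
    by_contra! hua
    simp only [Inner, not_forall, not_le] at hi
    obtain ⟨x, hx, hxv⟩ := hi
    have hax := hab.radius_le hx
    have := (hn x (Or.inl ⟨hua.trans_le hax, hxv⟩)).1
    exact (hab.radius_le (hx.trans this.le)).not_gt hua
  refine IsPlanarGraph.of_doubleArch _ r hr mid ?_ ?_ ?_
  · intro u v huv hlt w hw
    rcases hcases u v huv hlt with ⟨-, -, h⟩ | ⟨-, -, h⟩ | ⟨-, h⟩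
    · exact Or.inl (hr (hw.symm.trans h))
    · exact Or.inr (hr (hw.symm.trans h))
    · have := hpos u
      have := hpos v
      have := hpos w
      linarith
  · intro u v u' v' huv hlt huv' hlt' heq
    rcases hcases u v huv hlt with ⟨-, -, h⟩ | ⟨-, -, h⟩ | ⟨hc, h⟩
    · exact Or.inr ⟨u, h⟩
    · exact Or.inr ⟨v, h⟩
    · rcases hcases u' v' huv' hlt' with ⟨-, -, h'⟩ | ⟨-, -, h'⟩ | ⟨hc', h'⟩
      · exact Or.inr ⟨u', heq.trans h'⟩
      · exact Or.inr ⟨v', heq.trans h'⟩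
      · left
        rw [h, h'] at heq
        rcases hc.monotone hc' with ⟨h1, h2⟩ | ⟨h1, h2⟩
        · exact ⟨hr (by linarith), hr (by linarith)⟩
        · exact ⟨hr (by linarith), hr (by linarith)⟩
  · -- the pairs of edges, up to symmetry
    have upDown : ∀ u v u' v', Inner v → mid u v = r u → mid u' v' = r v' →
        ArchesAvoid (r u) (mid u v) (r u') (mid u' v') ∧
          ArchesAvoid (mid u v) (r v) (mid u' v') (r v') := by
      intro u v u' v' _ h h'
      rw [h, h']
      exact ⟨archesAvoid_self_left _ _ _, archesAvoid_self_right _ _ _⟩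
    -- The outer end of a center edge reaches `π`, so `Inner v` gives `r v ≤ r v'`, and the upper
    -- arch of the near-visible edge is nested inside that of the center edge.
    have upCenter : ∀ u v u' v', r u < r v → r u' < r v' → Inner v → mid u v = r u →
        CenterVisible r s u' v' → mid u' v' = -(r u' + r v') →
        ArchesAvoid (r u) (mid u v) (r u') (mid u' v') ∧
          ArchesAvoid (mid u v) (r v) (mid u' v') (r v') := by
      intro u v u' v' hlt hlt' hi h hc h'
      rw [h, h']
      have := hpos u
      have := hpos u'
      have := hpos v'
      exact ⟨archesAvoid_self_left _ _ _, (archesAvoid_of_nested (by linarith) hlt.le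
        (hi _ hc.pi_le) (Or.inl (by linarith))).symm⟩
    have downCenter : ∀ u v u' v', r u < r v → NearVisible r s u v → ¬ Inner v →
        mid u v = r v → CenterVisible r s u' v' → mid u' v' = -(r u' + r v') →
        ArchesAvoid (r u) (mid u v) (r u') (mid u' v') ∧
          ArchesAvoid (mid u v) (r v) (mid u' v') (r v') := by
      intro u v u' v' hlt hn hi h hc h'
      rw [h, h']
      have := hpos u'
      have := hpos v'
      refine ⟨(archesAvoid_of_disjoint ?_).symm, archesAvoid_self_left _ _ _⟩
      rw [min_eq_left hlt.le, max_eq_left (by linarith)]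
      exact houter u v hn hi hlt u' v' hc
    have centerCenter : ∀ u v u' v', CenterVisible r s u v → mid u v = -(r u + r v) →
        CenterVisible r s u' v' → mid u' v' = -(r u' + r v') → (u, v) ≠ (u', v') →
        r u ≤ r u' → r v ≤ r v' →
        ArchesAvoid (r u) (mid u v) (r u') (mid u' v') ∧
          ArchesAvoid (mid u v) (r v) (mid u' v') (r v') := by
      intro u v u' v' _ h _ h' hne h1 h2
      rw [h, h']
      have := hpos u
      have := hpos v
      have hlt : r u + r v < r u' + r v' := by
        refine lt_of_le_of_ne (by linarith) fun e => hne (Prod.ext (hr ?_) (hr ?_)) <;>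
          simp only <;> linarith
      exact ⟨archesAvoid_swap (archesAvoid_of_nested (by linarith) (by linarith) h1
        (Or.inl (by linarith))).symm, (archesAvoid_of_nested (by linarith) (by linarith) h2
        (Or.inl (by linarith))).symm⟩
    intro u v u' v' huv hlt huv' hlt' hne
    rcases hcases u v huv hlt with ⟨hn, hi, h⟩ | ⟨hn, hi, h⟩ | ⟨hc, h⟩ <;>
      rcases hcases u' v' huv' hlt' with ⟨hn', hi', h'⟩ | ⟨hn', hi', h'⟩ | ⟨hc', h'⟩
    · rw [h, h']
      exact ⟨archesAvoid_self_left _ _ _, hn.archesAvoid hr hn' hlt hlt' hne⟩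
    · exact upDown u v u' v' hi h h'
    · exact upCenter u v u' v' hlt hlt' hi h hc' h'
    · exact (upDown u' v' u v hi' h' h).imp ArchesAvoid.symm ArchesAvoid.symm
    · rw [h, h']
      exact ⟨hn.archesAvoid hr hn' hlt hlt' hne, archesAvoid_self_left _ _ _⟩
    · exact downCenter u v u' v' hlt hn hi h hc' h'
    · exact (upCenter u' v' u v hlt' hlt hi' h' hc h).imp ArchesAvoid.symm ArchesAvoid.symm
    · exact (downCenter u' v' u v hlt' hn' hi' h' hc h).imp ArchesAvoid.symm ArchesAvoid.symm
    · rcases hc.monotone hc' with ⟨h1, h2⟩ | ⟨h1, h2⟩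
      · exact centerCenter u v u' v' hc h hc' h' hne h1 h2
      · exact (centerCenter u' v' u v hc' h' hc h hne.symm h1 h2).imp
          ArchesAvoid.symm ArchesAvoid.symm

end InnermostGraph

/-! ### Ranks in ordered sets and the graphs of `j`-th partners. -/

/-- `v` is the element with index `j` in the set `S` ordered by `κ`. -/
def IsNth {V : Type*} (S : Set V) (κ : V → ℝ) (j : ℕ) (v : V) : Prop :=
  v ∈ S ∧ {x ∈ S | κ x < κ v}.ncard = j

theorem IsNth.unique {V : Type*} [Finite V] {S : Set V} {κ : V → ℝ} (hκ : Function.Injective κ)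
    {j : ℕ} {v w : V} (hv : IsNth S κ j v) (hw : IsNth S κ j w) : v = w := by
  have key : ∀ a b, IsNth S κ j a → IsNth S κ j b → ¬ κ a < κ b := by
    intro a b ha hb hlt
    have : {x ∈ S | κ x < κ a}.ncard < {x ∈ S | κ x < κ b}.ncard := by
      refine Set.ncard_lt_ncard ⟨fun x hx => ⟨hx.1, hx.2.trans hlt⟩, fun h => ?_⟩ (Set.toFinite _)
      exact lt_irrefl _ (h ⟨ha.1, hlt⟩).2
    rw [ha.2, hb.2] at this
    exact this.false
  exact hκ (le_antisymm (not_lt.1 (key w v hw hv)) (not_lt.1 (key v w hv hw)))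

theorem IsNth.of_encard_le {V : Type*} [Finite V] {S T : Set V} {κ : V → ℝ} {k : ℕ} {v : V}
    (hv : v ∈ S) (hT : T.encard ≤ k) (h : ∀ x ∈ S, κ x < κ v → x ∈ T) :
    ∃ j ≤ k, IsNth S κ j v := by
  refine ⟨_, ?_, hv, rfl⟩
  have h1 : {x ∈ S | κ x < κ v}.encard ≤ k :=
    (Set.encard_le_encard fun x hx => h x hx.1 hx.2).trans hT
  rw [← Set.Finite.cast_ncard_eq (Set.toFinite _)] at h1
  exact_mod_cast h1

theorem IsNth.not_lt_of_zero {V : Type*} [Finite V] {S : Set V} {κ : V → ℝ} {v x : V}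
    (h : IsNth S κ 0 v) (hx : x ∈ S) : κ v ≤ κ x := by
  by_contra! hlt
  have h0 := (Set.ncard_eq_zero (Set.toFinite _)).1 h.2
  exact (h0 ▸ (⟨hx, hlt⟩ : x ∈ {x ∈ S | κ x < κ v}) : x ∈ (∅ : Set V))

/-- The graph that joins each vertex `w` to the element with index `j` in `S w`. -/
def nthGraph {V : Type*} (S : V → Set V) (κ : V → V → ℝ) (j : ℕ) : SimpleGraph V where
  Adj u v := u ≠ v ∧ (IsNth (S u) (κ u) j v ∨ IsNth (S v) (κ v) j u)
  symm := ⟨fun _ _ h => ⟨h.1.symm, h.2.symm⟩⟩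
  loopless := ⟨fun _ h => h.1 rfl⟩

theorem isPlanarGraph_nthGraph {V : Type*} [Finite V] (S : V → Set V) {κ : V → V → ℝ}
    (hκ : ∀ v, Function.Injective (κ v)) (j : ℕ) : IsPlanarGraph (nthGraph S κ j) := by
  classical
  -- A vertex without a `j`-th partner is sent to itself, which creates no edge in `functionalGraph
  -- f`.
  let f : V → V := fun u => if h : ∃ v, IsNth (S u) (κ u) j v then h.choose else u
  have hf : ∀ u v, IsNth (S u) (κ u) j v → f u = v := by
    intro u v h
    have h' : ∃ v, IsNth (S u) (κ u) j v := ⟨v, h⟩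
    simp only [f, dif_pos h']
    exact h'.choose_spec.unique (hκ u) h
  exact (isPlanarGraph_functionalGraph f).mono fun u v h =>
    ⟨h.1, h.2.imp (hf u v) (hf v u)⟩

/-! ### Turning lines of sight to the tips of arcs. -/

section Sight

variable {V : Type*} (r s : V → ℝ)

/-- The arcs outside `w` that reach the angle of the tip of `w`. -/
def outerArcs (w : V) : Set V :=
  {x | s w ≤ s x ∧ r w < r x}

/-- The angle opposite to the tip of `w`. -/
noncomputable def oppositeAngle (w : V) : ℝ :=
  open Classical in if s w < Real.pi then s w + Real.pi else s w - Real.pi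

/-- The arcs met when one starts at the tip of `w`, moves inwards and goes on through the center. -/
def innerArcs (w : V) : Set V :=
  {x | x ≠ w ∧ (s w ≤ s x ∧ r x < r w ∨ oppositeAngle s w ≤ s x)}

/-- The arcs in `innerArcs r s w` are met for the first time in the order of this key. -/
noncomputable def innerKey (w x : V) : ℝ :=
  open Classical in if s w ≤ s x ∧ r x < r w then -r x else r x

variable {r s}

theorem innerKey_near {w x : V} (h : s w ≤ s x ∧ r x < r w) : innerKey r s w x = -r x :=
  if_pos h

theorem innerKey_far {w x : V} (h : ¬ (s w ≤ s x ∧ r x < r w)) : innerKey r s w x = r x :=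
  if_neg h

theorem innerKey_injective (hr : Function.Injective r) (hpos : ∀ v, 0 < r v) (w : V) :
    Function.Injective (innerKey r s w) := by
  intro x y hxy
  unfold innerKey at hxy
  have := hpos x
  have := hpos y
  split_ifs at hxy
  · exact hr (neg_injective hxy)
  · linarith
  · linarith
  · exact hr hxy

variable (r s) in
/-- `u` and `v` see each other on a ray from the center. -/
def RaySees (k : ℕ) (u v : V) : Prop :=
  ∃ t, t ≤ s u ∧ t ≤ s v ∧
    {w | w ≠ u ∧ w ≠ v ∧ t ≤ s w ∧ (r u < r w ∧ r w < r v ∨ r v < r w ∧ r w < r u)}.encard ≤ k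

variable (r s) in
/-- `u` and `v` see each other through the center, `u` at the smaller angle. -/
def CenterSees (k : ℕ) (u v : V) : Prop :=
  ∃ t, t ≤ s u ∧ 0 ≤ t ∧ t + Real.pi ≤ s v ∧
    {w | w ≠ u ∧ w ≠ v ∧ (t ≤ s w ∧ r w < r u ∨ t + Real.pi ≤ s w ∧ r w < r v)}.encard ≤ k

theorem RaySees.symm {k : ℕ} {u v : V} (h : RaySees r s k u v) : RaySees r s k v u := by
  obtain ⟨t, h1, h2, h3⟩ := h
  refine ⟨t, h2, h1, (Set.encard_le_encard ?_).trans h3⟩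
  rintro w ⟨h1, h2, h3, h4⟩
  exact ⟨h2, h1, h3, h4.symm⟩

/-- The ray is turned to the tip of the shorter arc `u`. An arc that reaches the tip angle also
reaches the original angle `t`, so the arcs met before `v` are among the at most `k` obstructing
ones. -/
theorem RaySees.exists_isNth [Finite V] (hr : Function.Injective r) (hpos : ∀ v, 0 < r v) {k : ℕ}
    {u v : V} (huv : u ≠ v) (h : RaySees r s k u v) (hle : s u ≤ s v) :
    ∃ j ≤ k, IsNth (outerArcs r s u) r j v ∨ IsNth (innerArcs r s u) (innerKey r s u) j v := by
  obtain ⟨t, hu, hv, hk⟩ := h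
  rcases lt_or_gt_of_ne (hr.ne huv) with hlt | hlt
  · obtain ⟨j, hj, h⟩ := IsNth.of_encard_le (S := outerArcs r s u) (κ := r) (v := v)
      ⟨hle, hlt⟩ hk (by
        rintro x ⟨h1, h2⟩ h3
        exact ⟨by rintro rfl; exact h2.false, by rintro rfl; exact h3.false, hu.trans h1,
          Or.inl ⟨h2, h3⟩⟩)
    exact ⟨j, hj, Or.inl h⟩
  · obtain ⟨j, hj, h⟩ := IsNth.of_encard_le (S := innerArcs r s u) (κ := innerKey r s u) (v := v)
      ⟨huv.symm, Or.inl ⟨hle, hlt⟩⟩ hk (by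
        rintro x ⟨h1, h2⟩ h3
        rw [innerKey_near ⟨hle, hlt⟩] at h3
        have hx : s u ≤ s x ∧ r x < r u := by
          by_contra hx
          rw [innerKey_far hx] at h3
          linarith [hpos x, hpos v]
        rw [innerKey_near hx] at h3
        exact ⟨h1, by rintro rfl; exact h3.false, hu.trans hx.1,
          Or.inr ⟨by linarith, hx.2⟩⟩)
    exact ⟨j, hj, Or.inr h⟩

/-- The line is turned until the first of its two ends reaches a tip: that of `u` if `s u + π ≤ s
v`, and otherwise that of `v`. No new arc becomes an obstruction, and from the tip the arcs are met
in the order of `innerKey`. -/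
theorem CenterSees.exists_isNth [Finite V] (hpos : ∀ v, 0 < r v)
    (hs : ∀ v, s v < 2 * Real.pi) {k : ℕ} {u v : V} (huv : u ≠ v) (h : CenterSees r s k u v) :
    ∃ j ≤ k, IsNth (innerArcs r s u) (innerKey r s u) j v ∨
      IsNth (innerArcs r s v) (innerKey r s v) j u := by
  obtain ⟨t, hu, h0, hv, hk⟩ := h
  rcases le_or_gt (s u + Real.pi) (s v) with hle | hlt
  · have hopp : oppositeAngle s u = s u + Real.pi := if_pos (by linarith [hs v])
    obtain ⟨j, hj, h⟩ := IsNth.of_encard_le (S := innerArcs r s u) (κ := innerKey r s u) (v := v)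
      ⟨huv.symm, Or.inr (hopp.trans_le hle)⟩ hk (by
        rintro x ⟨h1, h2⟩ h3
        refine ⟨h1, by rintro rfl; exact h3.false, ?_⟩
        by_cases hx : s u ≤ s x ∧ r x < r u
        · exact Or.inl ⟨hu.trans hx.1, hx.2⟩
        have h4 := h2.resolve_left hx
        rw [innerKey_far hx] at h3
        rw [hopp] at h4
        refine Or.inr ⟨by linarith, ?_⟩
        -- If `v` is already met on the near side, its key is negative, and no arc of the far side
        -- precedes it.
        by_cases hv' : s u ≤ s v ∧ r v < r u
        · rw [innerKey_near hv'] at h3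
          linarith [hpos x, hpos v]
        · rwa [innerKey_far hv'] at h3)
    exact ⟨j, hj, Or.inl h⟩
  · have hopp : oppositeAngle s v = s v - Real.pi := if_neg (by linarith)
    obtain ⟨j, hj, h⟩ := IsNth.of_encard_le (S := innerArcs r s v) (κ := innerKey r s v) (v := u)
      ⟨huv, Or.inr (by rw [hopp]; linarith)⟩ hk (by
        rintro x ⟨h1, h2⟩ h3
        refine ⟨by rintro rfl; exact h3.false, h1, ?_⟩
        by_cases hx : s v ≤ s x ∧ r x < r v
        · exact Or.inr ⟨hv.trans hx.1, hx.2⟩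
        have h4 := h2.resolve_left hx
        rw [innerKey_far hx] at h3
        rw [hopp] at h4
        refine Or.inl ⟨by linarith, ?_⟩
        by_cases hu' : s v ≤ s u ∧ r u < r v
        · rw [innerKey_near hu'] at h3
          linarith [hpos x, hpos u]
        · rwa [innerKey_far hu'] at h3)
    exact ⟨j, hj, Or.inr h⟩

theorem innermostGraph_adj_of_outer [Finite V] {w v : V} (hwv : w ≠ v)
    (h : IsNth (outerArcs r s w) r 0 v) : (innermostGraph r s).Adj w v := by
  refine ⟨hwv, Or.inl fun x hx => ?_⟩
  obtain ⟨hle, hlt⟩ := h.1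
  have hx' : r w < r x ∧ r x < r v := hx.resolve_right fun h' => by linarith [h'.1, h'.2]
  have : s x < s w := by
    by_contra! hsx
    exact (h.not_lt_of_zero ⟨hsx, hx'.1⟩).not_gt hx'.2
  exact ⟨this, this.trans_le hle⟩

/-- The first arc met inwards from the tip of `w` is either on the near side, which gives near
visibility, or beyond the center. In the latter case no arc that reaches the tip angle lies inside
`w`, so the line through the tip witnesses central visibility unless `w` itself reaches the opposite
angle and lies inside `v`. -/
theorem innermostGraph_adj_of_inner [Finite V] (hr : Function.Injective r) (hpos : ∀ v, 0 < r v)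
    (hs0 : ∀ v, 0 < s v) (hs : ∀ v, s v < 2 * Real.pi) {w v : V} (hwv : w ≠ v)
    (h : IsNth (innerArcs r s w) (innerKey r s w) 0 v) : (innermostGraph r s).Adj w v := by
  by_cases hv : s w ≤ s v ∧ r v < r w
  · refine ⟨hwv, Or.inl fun x hx => ?_⟩
    have hx' : r v < r x ∧ r x < r w := hx.resolve_left fun h' => by linarith [h'.1, h'.2]
    have : s x < s w := by
      by_contra! hsx
      have := h.not_lt_of_zero (x := x) ⟨by rintro rfl; exact hx'.2.false, Or.inl ⟨hsx, hx'.2⟩⟩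
      rw [innerKey_near hv, innerKey_near ⟨hsx, hx'.2⟩] at this
      linarith
    exact ⟨this, this.trans_le hv.1⟩
  have hrec : ∀ x, s w ≤ s x → r w ≤ r x := by
    intro x hx
    by_contra! hlt
    have := h.not_lt_of_zero (x := x) ⟨by rintro rfl; exact hlt.false, Or.inl ⟨hx, hlt⟩⟩
    rw [innerKey_far hv, innerKey_near ⟨hx, hlt⟩] at this
    linarith [hpos x, hpos v]
  have hfar : oppositeAngle s w ≤ s v := h.1.2.resolve_left hv
  have hmin : ∀ x, x ≠ w → oppositeAngle s w ≤ s x → r v ≤ r x := by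
    intro x hxw hx
    have := h.not_lt_of_zero (x := x) ⟨hxw, Or.inr hx⟩
    rw [innerKey_far hv] at this
    by_cases hx' : s w ≤ s x ∧ r x < r w
    · exact absurd (hrec x hx'.1) (not_le.2 hx'.2)
    · rwa [innerKey_far hx'] at this
  refine ⟨hwv, ?_⟩
  by_cases hw : s w < Real.pi
  · have hopp : oppositeAngle s w = s w + Real.pi := if_pos hw
    rw [hopp] at hfar hmin
    refine Or.inr (Or.inl ⟨s w, (hs0 w).le, le_rfl, hfar, hw.le, hrec, fun x hx => ?_⟩)
    refine hmin x ?_ hx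
    rintro rfl
    linarith [Real.pi_pos]
  · have hopp : oppositeAngle s w = s w - Real.pi := if_neg hw
    rw [hopp] at hfar hmin
    have hπ := Real.pi_pos
    rcases lt_or_gt_of_ne (hr.ne hwv) with hlt | hlt
    · -- `w` itself is met before `v` beyond the center, so `v` is visible on the ray of `v`
      refine Or.inl fun x hx => ?_
      have hx' : r w < r x ∧ r x < r v := hx.resolve_right fun h' => by linarith [h'.1, h'.2]
      have : s x < s w - Real.pi := by
        by_contra! hsx
        exact (hmin x (by rintro rfl; exact hx'.1.false) hsx).not_gt hx'.2
      exact ⟨by linarith, by linarith⟩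
    · refine Or.inr (Or.inr ⟨s w - Real.pi, by linarith, hfar, by linarith, by linarith [hs w],
        fun x hx => ?_, fun x hx => hrec x (by linarith)⟩)
      by_cases hxw : x = w
      · rw [hxw]
        exact hlt.le
      · exact hmin x hxw hx

theorem graphThickness_le_of_sees [Finite V] (hr : Function.Injective r) (hpos : ∀ v, 0 < r v)
    (hs0 : ∀ v, 0 < s v) (hs : ∀ v, s v < 2 * Real.pi) {k : ℕ} {G : SimpleGraph V}
    (hG : ∀ u v, G.Adj u v → RaySees r s k u v ∨ CenterSees r s k u v ∨ CenterSees r s k v u) :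
    graphThickness G ≤ ((2 * k + 1 : ℕ) : ℕ∞) := by
  let O : ℕ → SimpleGraph V := nthGraph (outerArcs r s) fun _ => r
  let I : ℕ → SimpleGraph V := nthGraph (innerArcs r s) (innerKey r s)
  -- Index `0` serves both classes of rank `0`; indices `1, …, k` are the outer classes and `k + 1,
  -- …, 2k` the inner classes of ranks `1, …, k`.
  let C : Fin (2 * k + 1) → SimpleGraph V := fun i =>
    if (i : ℕ) = 0 then innermostGraph r s
    else if (i : ℕ) ≤ k then O i else I (i - k)
  have hclass : ∀ u v, G.Adj u v → ∃ j ≤ k, (O j).Adj u v ∨ (I j).Adj u v := by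
    have hray : ∀ u v, u ≠ v → RaySees r s k u v → s u ≤ s v →
        ∃ j ≤ k, (O j).Adj u v ∨ (I j).Adj u v := by
      intro u v huv h hle
      obtain ⟨j, hj, h⟩ := h.exists_isNth hr hpos huv hle
      exact ⟨j, hj, h.imp (fun h => ⟨huv, Or.inl h⟩) fun h => ⟨huv, Or.inl h⟩⟩
    have hcenter : ∀ u v, u ≠ v → CenterSees r s k u v → ∃ j ≤ k, (I j).Adj u v := by
      intro u v huv h
      obtain ⟨j, hj, h⟩ := h.exists_isNth hpos hs huv
      exact ⟨j, hj, huv, h⟩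
    intro u v huv
    rcases hG u v huv with h | h | h
    · rcases le_total (s u) (s v) with hle | hle
      · exact hray u v huv.ne h hle
      · obtain ⟨j, hj, h⟩ := hray v u huv.ne' h.symm hle
        exact ⟨j, hj, h.imp SimpleGraph.Adj.symm SimpleGraph.Adj.symm⟩
    · obtain ⟨j, hj, h⟩ := hcenter u v huv.ne h
      exact ⟨j, hj, Or.inr h⟩
    · obtain ⟨j, hj, h⟩ := hcenter v u huv.ne' h
      exact ⟨j, hj, Or.inr h.symm⟩
  refine graphThickness_le_of_cover C (fun i => ?_) fun u v huv => ?_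
  · simp only [C]
    split_ifs
    · exact isPlanarGraph_innermostGraph hr hpos
    · exact isPlanarGraph_nthGraph _ (fun _ => hr) _
    · exact isPlanarGraph_nthGraph _ (innerKey_injective hr hpos) _
  · obtain ⟨j, hj, h⟩ := hclass u v huv
    rcases Nat.eq_zero_or_pos j with rfl | hj0
    · refine ⟨⟨0, by omega⟩, ?_⟩
      simp only [C, if_true]
      rcases h with ⟨hne, h | h⟩ | ⟨hne, h | h⟩
      · exact innermostGraph_adj_of_outer hne h
      · exact (innermostGraph_adj_of_outer hne.symm h).symm
      · exact innermostGraph_adj_of_inner hr hpos hs0 hs hne h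
      · exact (innermostGraph_adj_of_inner hr hpos hs0 hs hne.symm h).symm
    · rcases h with h | h
      · refine ⟨⟨j, by omega⟩, ?_⟩
        simpa only [C, if_neg hj0.ne', if_pos hj] using h
      · refine ⟨⟨j + k, by omega⟩, ?_⟩
        have h1 : j + k ≠ 0 := by omega
        have h2 : ¬ j + k ≤ k := by omega
        simpa only [C, if_neg h1, if_neg h2, Nat.add_sub_cancel] using h

end Sight

/-! ### From segments in the plane to radii and angles. -/

namespace SemiArcRepresentation

variable {V : Type*} (R : SemiArcRepresentation V)

/-- Arcs of equal radius would share their starting point on the common ray. -/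
theorem radius_injective : Function.Injective R.radius := by
  intro u v h
  by_contra hne
  refine Set.disjoint_left.1 (R.disjoint_arcs u v hne) ⟨0, ⟨le_rfl, (R.sweep_pos u).le⟩, rfl⟩
    ⟨0, ⟨le_rfl, (R.sweep_pos v).le⟩, ?_⟩
  simp only [h]

theorem mem_arc {w : V} {t : ℝ} (h0 : 0 ≤ t) (h : t ≤ R.sweep w) :
    R.center + R.radius w * Complex.exp ((R.start + t : ℝ) * Complex.I) ∈ R.arc w :=
  ⟨t, ⟨h0, h⟩, rfl⟩

theorem exp_add_pi (t : ℝ) : Complex.exp ((R.start + (t + Real.pi) : ℝ) * Complex.I) =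
    -Complex.exp ((R.start + t : ℝ) * Complex.I) := by
  rw [← Complex.exp_add_pi_mul_I]
  congr 1
  push_cast
  ring

theorem mem_segment_line (c e : ℂ) {a b x : ℝ} (h : x ∈ Set.uIcc a b) :
    c + x * e ∈ segment ℝ (c + a * e) (c + b * e) := by
  rw [← segment_eq_uIcc] at h
  obtain ⟨p, q, hp, hq, hpq, rfl⟩ := h
  refine ⟨p, q, hp, hq, hpq, ?_⟩
  have : (p : ℂ) + q = 1 := by exact_mod_cast hpq
  simp only [Complex.real_smul, smul_eq_mul]
  push_cast
  linear_combination c * this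

theorem sin_sub_eq_zero_of_collinear {c : ℂ} {a b α β : ℝ} (ha : 0 < a) (hb : 0 < b)
    (h : Collinear ℝ {c, c + a * Complex.exp (α * Complex.I), c + b * Complex.exp (β * Complex.I)}) :
    Real.sin (β - α) = 0 := by
  obtain ⟨d, hd⟩ := (collinear_iff_of_mem (p₀ := c) (by simp)).1 h
  obtain ⟨x, hx⟩ := hd (c + a * Complex.exp (α * Complex.I)) (by simp)
  obtain ⟨y, hy⟩ := hd (c + b * Complex.exp (β * Complex.I)) (by simp)
  rw [vadd_eq_add, add_comm c] at hx hy
  have hx := add_right_cancel hx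
  have hy := add_right_cancel hy
  have x1 := congrArg Complex.re hx
  have x2 := congrArg Complex.im hx
  have y1 := congrArg Complex.re hy
  have y2 := congrArg Complex.im hy
  simp only [Complex.re_ofReal_mul, Complex.im_ofReal_mul, Complex.exp_ofReal_mul_I_re,
    Complex.exp_ofReal_mul_I_im, Complex.real_smul] at x1 x2 y1 y2
  rw [Real.sin_sub]
  -- The left side is the cross product of the two points relative to `c`, which vanishes because
  -- both are multiples of `d`.
  have : a * b * (Real.sin β * Real.cos α - Real.cos β * Real.sin α) = 0 := by
    linear_combination (b * Real.sin β) * x1 - (b * Real.cos β) * x2 + (x * d.re) * y2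
      - (x * d.im) * y1
  exact (mul_eq_zero.1 this).resolve_left (mul_pos ha hb).ne'

theorem sees_cases {k : ℕ} {u v : V} (h : R.Sees k u v) :
    RaySees R.radius R.sweep k u v ∨ CenterSees R.radius R.sweep k u v ∨
      CenterSees R.radius R.sweep k v u := by
  have center : ∀ u v t, 0 ≤ t → t ≤ R.sweep u → t + Real.pi ≤ R.sweep v →
      {w : V | w ≠ u ∧ w ≠ v ∧ (segment ℝ
        (R.center + R.radius u * Complex.exp ((R.start + t : ℝ) * Complex.I))
        (R.center + R.radius v * Complex.exp ((R.start + (t + Real.pi) : ℝ) * Complex.I)) ∩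
          R.arc w).Nonempty}.encard ≤ k → CenterSees R.radius R.sweep k u v := by
    intro u v t h0 hu hv hk
    refine ⟨t, hu, h0, hv, (Set.encard_le_encard ?_).trans hk⟩
    rintro w ⟨h1, h2, h3⟩
    refine ⟨h1, h2, ?_⟩
    have pu := R.radius_pos u
    have pv := R.radius_pos v
    have pw := R.radius_pos w
    have hseg : ∀ x : ℝ, -R.radius v ≤ x → x ≤ R.radius u →
        R.center + x * Complex.exp ((R.start + t : ℝ) * Complex.I) ∈ segment ℝ
        (R.center + R.radius u * Complex.exp ((R.start + t : ℝ) * Complex.I))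
        (R.center + R.radius v * Complex.exp ((R.start + (t + Real.pi) : ℝ) * Complex.I)) := by
      intro x hx hx'
      rw [R.exp_add_pi, mul_neg, ← neg_mul, ← Complex.ofReal_neg]
      exact mem_segment_line _ _ (Set.mem_uIcc.2 (Or.inr ⟨hx, hx'⟩))
    rcases h3 with ⟨h3, h4⟩ | ⟨h3, h4⟩
    · exact ⟨_, hseg (R.radius w) (by linarith) h4.le, R.mem_arc h0 h3⟩
    · refine ⟨_, hseg (-R.radius w) (by linarith) (by linarith), ?_⟩
      have := R.mem_arc (w := w) (by linarith [Real.pi_pos]) h3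
      rwa [R.exp_add_pi, mul_neg, ← neg_mul, ← Complex.ofReal_neg] at this
  obtain ⟨_, ⟨t, ⟨ht0, ht⟩, rfl⟩, _, ⟨t', ⟨ht0', ht'⟩, rfl⟩, hc, hk⟩ := h
  have hsin := sin_sub_eq_zero_of_collinear (R.radius_pos u) (R.radius_pos v) hc
  rw [add_sub_add_left_eq_sub] at hsin
  have hπ := Real.pi_pos
  have b1 := R.sweep_lt u
  have b2 := R.sweep_lt v
  obtain ⟨n, hn⟩ := Real.sin_eq_zero_iff.1 hsin
  -- Both angles lie in `[0, 2π)`, so they differ by `0` (same ray) or by `±π` (opposite rays, with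
  -- either end at the smaller angle).
  have n1 : n < 2 := by
    have : (n : ℝ) * Real.pi < 2 * Real.pi := by linarith
    exact_mod_cast lt_of_mul_lt_mul_right this hπ.le
  have n2 : -2 < n := by
    have : (-2 : ℝ) * Real.pi < n * Real.pi := by linarith
    exact_mod_cast lt_of_mul_lt_mul_right this hπ.le
  obtain rfl | rfl | rfl : n = 0 ∨ n = 1 ∨ n = -1 := by omega
  · left
    obtain rfl : t' = t := by
      push_cast at hn
      linarith
    refine ⟨t', ht, ht', (Set.encard_le_encard ?_).trans hk⟩
    rintro w ⟨h1, h2, h3, h4⟩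
    refine ⟨h1, h2, _, mem_segment_line _ _ (Set.mem_uIcc.2 ?_), R.mem_arc ht0 h3⟩
    exact h4.imp (fun h => ⟨h.1.le, h.2.le⟩) fun h => ⟨h.1.le, h.2.le⟩
  · obtain rfl : t' = t + Real.pi := by
      push_cast at hn
      linarith
    exact Or.inr (Or.inl (center u v t ht0 ht ht' hk))
  · obtain rfl : t = t' + Real.pi := by
      push_cast at hn
      linarith
    refine Or.inr (Or.inr (center v u t' ht0' ht' ht ((Set.encard_le_encard ?_).trans hk)))
    rintro w ⟨h1, h2, h3⟩
    rw [segment_symm] at h3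
    exact ⟨h2, h1, h3⟩

end SemiArcRepresentation

theorem mainTheorem6 {V : Type*} [Finite V] (k : ℕ) (G : SimpleGraph V)
    (hG : IsSemiArcVisibilityGraph k G) :
    graphThickness G ≤ ((2 * k + 1 : ℕ) : ℕ∞) := by
  obtain ⟨R, rfl⟩ := hG
  exact graphThickness_le_of_sees R.radius_injective R.radius_pos R.sweep_pos R.sweep_lt
    fun u v h => R.sees_cases h.2
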